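/- Network. There are $K_T$ transmitters and $K_R\ge 1$ receivers, all with one antenna, and a library of $N\ge1$ files of $F\ge1$ packets each. They are connected by two parallel subchannels, $$Y^{(p)}_j(t)=\sqrt{P^{\alpha}}\sum_i h^{(p)}_{ji}(t)X^{(p)}_i(t)+Z^{(p)}_j(t),\qquad Y^{(n)}_j(t)=\sqrt{P^{\bar\alpha}}\sum_i h^{(n)}_{ji}(t)X^{(n)}_i(t)+Z^{(n)}_j(t),$$ with $\alpha\in[0,1]$, $\bar\alpha=1-\alpha$, SNR $P$, unit-variance noise and power constraints $\mathbb E|X_i|^2\le 1$. The matrices $h^{(p)}(t)$, $h^{(n)}(t)$ are random, and for each $t$ each of them has a joint density. The transmitters know $h^{(p)}$ perfectly (P-subchannel) and do not know $h^{(n)}$ (N-subchannel). Placement. Transmitter $i$ caches a set $\mathcal P_i$ of packets with $|\mathcal P_i|=\mu_T NF$, and receiver $j$ a set $\mathcal U_j$ with $|\mathcal U_j|=\mu_R NF$; placement is uncoded, at packet level, possibly centrally coordinated, and independent of the demands. Here $0\le\mu_T\le1$, $0\le\mu_R<1$, $K_T\mu_T$ and $K_R\mu_R$ are integers, and $K_T\mu_T\ge1$.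 Delivery. Receiver $j$ requests a file $d_j\in\{1,\dots,N\}$ and has to obtain the packets of that file which it has not cached. Let $D(\mathbf d)$ be the total number of these packets, summed over the receivers. Every packet is split into a P-subpacket (a fraction $q\in[0,1]$ of its bits) and an N-subpacket (the remaining fraction $\bar q=1-q$), where $q$ depends neither on the fading coefficients nor on the demands. P-subpackets are delivered over the P-subchannel in $H^{(p)}$ blocks and N-subpackets over the N-subchannel in $H^{(n)}$ blocks. In each block a set of receivers is served, each of them with one missing subpacket, distinct receivers with distinct subpackets. In every channel use of the block, transmitter $i$ sends a linear combination of the current (unit-variance) symbols of those coded subpackets of the block that it has cached. Its coefficients may depend on the realization of $h^{(p)}$ in the P-subchannel and must be independent of $h^{(n)}$ in the N-subchannel. The block is feasible if such beamformers exist for which, almost surely, in every channel use of the block, each served receiver can combine its received symbol linearly with the symbols of its cached coded subpackets so as to obtain its intended symbol in unit-variance noise with signal gain $\sqrt{P^{\alpha}}\,g$ (respectively $\sqrt{P^{\bar\alpha}}\,g$), where $g\neq0$ does not depend on $P$. All blocks must be feasible, and together they must deliver to every receiver all its missing P- and N-subpackets. The delivery time is $\max\{\frac{q}{\alpha}H^{(p)},\frac{\bar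 q}{\bar\alpha}H^{(n)}\}$ time-slots (with $0/0=0$ and $x/0=\infty$ for $x>0$). DoF. The one-shot linear DoF of a placement and a splitting ratio $q$ is the infimum, over the demand vectors $\mathbf d$ with $D(\mathbf d)>0$, of the supremum of $D(\mathbf d)/\max\{\frac{q}{\alpha}H^{(p)},\frac{\bar q}{\bar\alpha}H^{(n)}\}$ over all such deliveries. The optimal one-shot linear DoF $\mathsf{DoF}^*_L(\mu_T,\mu_R,\alpha)$ is the supremum of this quantity over all placements of the given cache sizes and all $q\in[0,1]$. Theorem. Let $$\mathsf{DoF}_{L,C}(\mu_T,\mu_R,\alpha)=\alpha\min\{K_T\mu_T+K_R\mu_R,K_R\}+\bar\alpha\min\{1+K_R\mu_R,K_R\}.$$ (i) $\mathsf{DoF}_{L,C}(\mu_T,\mu_R,\alpha)$ is achievable: there is an integer $F_0\ge1$, depending only on $K_T,K_R,\mu_T,\mu_R$, such that whenever $F_0$ divides $F$, some placement of the given cache sizes and some $q\in[0,1]$ have one-shot linear DoF at least $\mathsf{DoF}_{L,C}(\mu_T,\mu_R,\alpha)$. (ii) For every $F\ge1$, $\mathsf{DoF}_{L,C}(\mu_T,\mu_R,\alpha)\ge\frac12\,\mathsf{DoF}^*_L(\mu_T,\mu_R,\alpha)$.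 -/

import Mathlib

open MeasureTheory ProbabilityTheory
open scoped ENNReal

noncomputable section

namespace CacheNet

/-- A packet of the library: `(n, f)` is packet `f` of file `n`
(`N` files, `F` packets per file). -/
abbrev Packet (N F : ℕ) : Type := Fin N × Fin F

/-- The channel coefficients of one subchannel at one channel use:
`h j i` is the coefficient from transmitter `i` to receiver `j`. -/
abbrev ChannelMatrix (KT KR : ℕ) : Type := Fin KR → Fin KT → ℂ

/-- The physical network: `KT` single-antenna transmitters and `KR` single-antenna receivers,
joined by a P-subchannel of normalized capacity `α` and an N-subchannel of normalized
capacity `1 - α`.  The fading processes are random processes on a probability space; "continuous"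
fading means that the joint law of the coefficients at each channel use has a density.
A P-block (N-block) spans `lenP q` (`lenN q`) channel uses when the splitting ratio is `q`. -/
structure Network (KT KR : ℕ) (Ω : Type*) [MeasurableSpace Ω] where
  /-- the probability measure -/
  law : Measure Ω
  isProb : IsProbabilityMeasure law
  /-- normalized capacity of the P-subchannel -/
  α : ℝ
  α_nonneg : 0 ≤ α
  α_le_one : α ≤ 1
  /-- fading process of the P-subchannel -/
  hP : ℕ → Ω → ChannelMatrix KT KR
  /-- fading process of the N-subchannel -/
  hN : ℕ → Ω → ChannelMatrix KT KR
  measurable_hP : ∀ t, Measurable (hP t)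
  measurable_hN : ∀ t, Measurable (hN t)
  continuous_hP : ∀ t, law.map (hP t) ≪ volume
  continuous_hN : ∀ t, law.map (hN t) ≪ volume
  lenP : ℝ → ℕ
  lenN : ℝ → ℕ
  lenP_pos : ∀ q, 0 < lenP q
  lenN_pos : ∀ q, 0 < lenN q

section Model

variable {KT KR N F : ℕ}

/-- An uncoded placement at the packet level: every node stores a set of packets. -/
structure Placement (KT KR N F : ℕ) where
  /-- cache contents of the transmitters -/
  tx : Fin KT → Finset (Packet N F)
  /-- cache contents of the receivers -/
  rx : Fin KR → Finset (Packet N F)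

/-- The cache size constraints `|P_i| = μT N F` and `|U_j| = μR N F`. -/
def Placement.Admissible (C : Placement KT KR N F) (μT μR : ℝ) : Prop :=
  (∀ i, ((C.tx i).card : ℝ) = μT * N * F) ∧ (∀ j, ((C.rx j).card : ℝ) = μR * N * F)

/-- The packets of the file `d j` requested by receiver `j` that `j` has not cached. -/
def missing (C : Placement KT KR N F) (d : Fin KR → Fin N) (j : Fin KR) :
    Finset (Packet N F) :=
  Finset.univ.filter fun p => p.1 = d j ∧ p ∉ C.rx j

/-- The number of packets to be delivered, each counted once for every receiver that needs it. -/
def numMissing (C : Placement KT KR N F) (d : Fin KR → Fin N) : ℕ :=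
  ∑ j, (missing C d j).card

/-- What is to be delivered in one block: a set `served` of receivers, and for each served receiver
`j` the subpacket `target j` intended for it; a subpacket is intended for exactly one receiver.
(The values of `target` outside `served` are irrelevant.) -/
structure Block (KR N F : ℕ) where
  served : Finset (Fin KR)
  target : Fin KR → Packet N F
  inj : Set.InjOn target served

/-- The set of subpackets transmitted in a block. -/
def Block.packets (b : Block KR N F) : Finset (Packet N F) :=
  b.served.image b.target

/-- The signal sent by transmitter `i` in one channel use: a linear combination, with beamforming
coefficients `v`, of the symbols `w` of the coded subpackets of the block that `i` has cached. -/
def txSignal (C : Placement KT KR N F) (b : Block KR N F)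
    (v : Fin KT → Packet N F → ℂ) (w : Packet N F → ℂ) (i : Fin KT) : ℂ :=
  ∑ p ∈ C.tx i ∩ b.packets, v i p * w p

/-- The signal received by receiver `j` over a subchannel of normalized capacity `γ` at SNR `P`,
with noise `z`. -/
def rxSignal (γ P : ℝ) (h : ChannelMatrix KT KR) (X : Fin KT → ℂ) (z : ℂ) (j : Fin KR) : ℂ :=
  (Real.sqrt (P ^ γ) : ℂ) * ∑ i, h j i * X i + z

/-- The power constraint `E |X_i|² ≤ 1` at every transmitter, for independent zero-mean unit-variance
symbols of the coded subpackets. -/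
def PowerConstraint (C : Placement KT KR N F) (b : Block KR N F)
    (v : Fin KT → Packet N F → ℂ) : Prop :=
  ∀ i, ∑ p ∈ C.tx i ∩ b.packets, ‖v i p‖ ^ 2 ≤ 1

/-- Receiver `j` can combine its received symbol linearly with the symbols of its cached coded
subpackets, so that the intended symbol is left in unmodified noise: the outcome is a point-to-point
channel `√(P^γ) g w + z` whose gain `g ≠ 0` does not depend on the SNR `P`
(its capacity is `γ log P + o(log P)`). -/
def Recovers (γ : ℝ) (C : Placement KT KR N F) (b : Block KR N F) (h : ChannelMatrix KT KR)
    (v : Fin KT → Packet N F → ℂ) (j : Fin KR) : Prop :=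
  ∃ g : ℂ, g ≠ 0 ∧ ∀ P : ℝ, 0 < P → ∃ a : Packet N F → ℂ,
    ∀ (w : Packet N F → ℂ) (z : ℂ),
      rxSignal γ P h (txSignal C b v w) z j + ∑ p ∈ C.rx j, a p * w p
        = (Real.sqrt (P ^ γ) : ℂ) * (g * w (b.target j)) + z

/-- One successful channel use: the beamformers `v` respect the power constraints and every served
receiver recovers its symbol. -/
def Success (γ : ℝ) (C : Placement KT KR N F) (b : Block KR N F) (h : ChannelMatrix KT KR)
    (v : Fin KT → Packet N F → ℂ) : Prop :=
  PowerConstraint C b v ∧ ∀ j ∈ b.served, Recovers γ C b h v j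

/-- The channel uses of block number `m`, when blocks span `B` channel uses. -/
def blockTimes (B m : ℕ) : Finset ℕ := Finset.Ico (m * B) ((m + 1) * B)

variable {Ω : Type*} [MeasurableSpace Ω]

/-- Success of the P-block number `m`: almost surely, in every channel use of the block there are
suitable beamformers.  They are chosen after the channel realization (perfect CSIT), separately for
each channel use (one-shot). -/
def PFeasible (net : Network KT KR Ω) (C : Placement KT KR N F) (q : ℝ) (m : ℕ)
    (b : Block KR N F) : Prop :=
  ∀ᵐ ω ∂net.law, ∀ t ∈ blockTimes (net.lenP q) m,
    ∃ v : Fin KT → Packet N F → ℂ, Success net.α C b (net.hP t ω) v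

/-- Success of the N-block number `m`: there are (possibly random) beamformers, independent of the
fading process of the N-subchannel (no CSIT), that almost surely succeed in every channel use of the
block. -/
def NFeasible (net : Network KT KR Ω) (C : Placement KT KR N F) (q : ℝ) (m : ℕ)
    (b : Block KR N F) : Prop :=
  ∃ v : ℕ → Ω → Fin KT → Packet N F → ℂ,
    (∀ t, Measurable (v t)) ∧
    IndepFun (fun ω t => v t ω) (fun ω t => net.hN t ω) net.law ∧
    ∀ᵐ ω ∂net.law, ∀ t ∈ blockTimes (net.lenN q) m,
      Success (1 - net.α) C b (net.hN t ω) (v t ω)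

/-- The blocks `b 0, …, b (H - 1)` deliver the demands `d` over one subchannel: each block is feasible,
serves only missing subpackets, and every receiver gets every subpacket that it misses. -/
def Delivers (feasible : ℕ → Block KR N F → Prop) (C : Placement KT KR N F)
    (d : Fin KR → Fin N) {H : ℕ} (b : Fin H → Block KR N F) : Prop :=
  (∀ m : Fin H, feasible m (b m)) ∧
  (∀ m, ∀ j ∈ (b m).served, (b m).target j ∈ missing C d j) ∧
  (∀ j, ∀ p ∈ missing C d j, ∃ m, j ∈ (b m).served ∧ (b m).target j = p)

/-- The delivery time `max {(q/α) HP, ((1-q)/(1-α)) HN}` in time-slots.  In `ℝ≥0∞` one has `0/0 = 0`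
(empty subpackets take no time) and `x/0 = ∞` for `x > 0` (nonempty subpackets cannot be sent over a
subchannel of capacity zero). -/
def deliveryTime (α q : ℝ) (HP HN : ℕ) : ℝ≥0∞ :=
  max (ENNReal.ofReal q / ENNReal.ofReal α * HP)
    (ENNReal.ofReal (1 - q) / ENNReal.ofReal (1 - α) * HN)

/-- The maximum achievable one-shot linear DoF for worst-case demands, for a fixed placement and
splitting ratio.  Demands that require no delivery at all (ratio "0/0") do not count. -/
def dofOf (net : Network KT KR Ω) (C : Placement KT KR N F) (q : ℝ) : ℝ≥0∞ :=
  ⨅ (d : Fin KR → Fin N) (_ : 0 < numMissing C d),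
    ⨆ (HP : ℕ) (HN : ℕ) (bP : Fin HP → Block KR N F) (bN : Fin HN → Block KR N F)
      (_ : Delivers (PFeasible net C q) C d bP) (_ : Delivers (NFeasible net C q) C d bN),
      (numMissing C d : ℝ≥0∞) / deliveryTime net.α q HP HN

/-- The one-shot linear DoF of the network with `N` files of `F` packets: the supremum over all
admissible placements and splitting ratios. -/
def dofStar (net : Network KT KR Ω) (N F : ℕ) (μT μR : ℝ) : ℝ≥0∞ :=
  ⨆ (C : Placement KT KR N F) (q : ℝ) (_ : C.Admissible μT μR) (_ : q ∈ Set.Icc (0 : ℝ) 1),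
    dofOf net C q

end Model

/-- `α min {KT μT + KR μR, KR} + (1 - α) min {1 + KR μR, KR}`. -/
def dofCentralized (KT KR : ℕ) (μT μR α : ℝ) : ℝ :=
  α * min (KT * μT + KR * μR) KR + (1 - α) * min (1 + KR * μR) KR

end CacheNet

end

noncomputable section

namespace CacheNet

/-! ### Generic channel matrices -/

section Generic

variable {KT KR : ℕ}

/-! Write `S = KT μT`, `R = KR μR`. In a feasible block, a packet must vanish at every served
receiver that neither wants nor caches it. Almost surely all minors of the channel are nonzero, so
with CSIT a packet held by `s` transmitters can be nulled at up to `s - 1` receivers while reaching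
its own. Without CSIT it cannot be nulled anywhere, because a nonzero beam independent of the
channel is almost surely not orthogonal to it. So a block containing a packet cached at `s`
transmitters and `r` receivers serves at most `s + r` receivers on the P-subchannel and `1 + r` on
the N-subchannel (`PFeasible.card_served_le`, `NFeasible.card_served_le`).

Converse (`rate_le`, `dofOf_le`): summed over the constant demands, a packet counts with weight `KR
- r`, and convexity of `1/ℓ` bounds the number of blocks through the weighted mean of the block-size
bound. The weight decreases in `r`, so the mean of `r` is at most `R`. But `s` may be large where
`r` is small, so its mean is only bounded by `KR S / (KR - R)`. This is at most `2 S` if `2 R ≤ KR`;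
otherwise the trivial block size `KR` is at most `2 R`. Only the P-subchannel needs the factor 2. As
`q` is the same for all demands, the bounds on `x q` and `x (1 - q)` add up.

Achievability (`exists_blocks`, `le_dofOf`): index packets by permutations of the nodes and cache a
packet where its permutation takes small values. Then each packet of a block is known at `R` other
served receivers. Blocks of `min (S + R) KR` and of `R + 1` receivers reach the counting bounds, and
`q` is chosen to balance the two subchannels. -/

instance : (volume : Measure (ChannelMatrix KT KR)).IsAddHaarMeasure :=
  Measure.pi.isAddHaarMeasure _

/-- All square minors of the channel matrix are nonzero. -/
def Generic (h : ChannelMatrix KT KR) : Prop :=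
  ∀ (n : ℕ) (f : Fin n → Fin KR) (g : Fin n → Fin KT), f.Injective → g.Injective →
    (Matrix.of fun a b => h (f a) (g b)).det ≠ 0

/-- It suffices to test lines `y + x • J`, where `J` restricts to the identity on the chosen rows
and columns. There the minor is `det (x + M)`, the characteristic polynomial of `-M` at `x`, which
is monic and so has finitely many roots. -/
lemma ae_minor_ne_zero {n : ℕ} {f : Fin n → Fin KR} {g : Fin n → Fin KT}
    (hf : f.Injective) (hg : g.Injective) :
    ∀ᵐ h : ChannelMatrix KT KR, (Matrix.of fun a b => h (f a) (g b)).det ≠ 0 := by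
  classical
  let J : ChannelMatrix KT KR := fun j i => if ∃ a, f a = j ∧ g a = i then 1 else 0
  have hJ : ∀ a b, J (f a) (g b) = (1 : Matrix (Fin n) (Fin n) ℂ) a b := by
    intro a b
    simp only [J, Matrix.one_apply]
    congr 1
    refine propext ⟨?_, fun h => ⟨a, rfl, by rw [h]⟩⟩
    rintro ⟨c, h1, h2⟩
    rw [← hf h1, hg h2]
  let L : ℝ →ₗ[ℝ] ChannelMatrix KT KR := LinearMap.toSpanSingleton ℝ _ J
  have hmeas : MeasurableSet
      {h : ChannelMatrix KT KR | (Matrix.of fun a b => h (f a) (g b)).det ≠ 0} := by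
    have hc : Continuous fun h : ChannelMatrix KT KR =>
        (Matrix.of fun a b => h (f a) (g b)).det := by
      refine Continuous.matrix_det ?_
      refine continuous_matrix fun a b => ?_
      simp only [Matrix.of_apply]
      fun_prop
    exact (isOpen_ne.preimage hc).measurableSet
  refine (ae_mem_of_ae_add_linearMap_mem L volume volume hmeas fun y => ?_).mono fun _ h => h
  set M : Matrix (Fin n) (Fin n) ℂ := Matrix.of fun a b => y (f a) (g b) with hM
  have hfin : {x : ℂ | (-M).charpoly.IsRoot x}.Finite :=
    Polynomial.finite_setOfPred_isRoot (Matrix.charpoly_monic _).ne_zero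
  have hfin' : {x : ℝ | (-M).charpoly.IsRoot (x : ℂ)}.Finite :=
    hfin.preimage Complex.ofReal_injective.injOn
  filter_upwards [hfin'.measure_zero volume |> compl_mem_ae_iff.2] with x hx
  simp only [Set.mem_compl_iff, Set.mem_ofPred_eq, Polynomial.IsRoot] at hx
  convert hx using 1
  rw [Matrix.eval_charpoly]
  congr 1
  ext a b
  simp [L, hJ, hM, Matrix.one_apply, Matrix.scalar_apply, Matrix.diagonal_apply, add_comm]

lemma ae_generic : ∀ᵐ h : ChannelMatrix KT KR, Generic h := by
  unfold Generic
  simp only [ae_all_iff]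
  exact fun n f g hf hg => ae_minor_ne_zero hf hg

lemma Generic.eq_zero {h : ChannelMatrix KT KR} (hh : Generic h) {Z : Finset (Fin KR)}
    {τ : Finset (Fin KT)} (hcard : τ.card ≤ Z.card) {u : Fin KT → ℂ}
    (hu : ∀ j ∈ Z, ∑ i ∈ τ, h j i * u i = 0) : ∀ i ∈ τ, u i = 0 := by
  obtain ⟨Z', hZ', hc⟩ := Finset.exists_subset_card_eq hcard
  let f := Z'.equivFinOfCardEq hc
  let g := τ.equivFin
  have hdet := hh τ.card (fun a => f.symm a) (fun a => g.symm a)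
    (Subtype.val_injective.comp f.symm.injective) (Subtype.val_injective.comp g.symm.injective)
  have := Matrix.eq_zero_of_mulVec_eq_zero hdet (v := fun a => u (g.symm a)) (by
    ext a
    simp only [Matrix.mulVec, dotProduct, Matrix.of_apply, Pi.zero_apply]
    rw [← hu (f.symm a) (hZ' (f.symm a).2), ← Finset.sum_coe_sort τ]
    exact g.symm.sum_comp fun i : τ => h (f.symm a) i * u i)
  intro i hi
  simpa using congrFun this (g ⟨i, hi⟩)

lemma Generic.exists_solution {h : ChannelMatrix KT KR} (hh : Generic h) {Z : Finset (Fin KR)}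
    {τ : Finset (Fin KT)} (hcard : Z.card ≤ τ.card) (c : Fin KR → ℂ) :
    ∃ u : Fin KT → ℂ, ∀ j ∈ Z, ∑ i ∈ τ, h j i * u i = c j := by
  classical
  obtain ⟨τ', hτ', hc⟩ := Finset.exists_subset_card_eq hcard
  let f := Z.equivFin
  let g := τ'.equivFinOfCardEq hc
  have hdet := hh Z.card (fun a => f.symm a) (fun a => g.symm a)
    (Subtype.val_injective.comp f.symm.injective) (Subtype.val_injective.comp g.symm.injective)
  set M := Matrix.of fun a b => h (f.symm a) (g.symm b)
  let x := M⁻¹.mulVec fun a => c (f.symm a)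
  have hx : M.mulVec x = fun a => c (f.symm a) := by
    simp only [x, Matrix.mulVec_mulVec, Matrix.mul_nonsing_inv M (isUnit_iff_ne_zero.2 hdet),
      Matrix.one_mulVec]
  refine ⟨fun i => if hi : i ∈ τ' then x (g ⟨i, hi⟩) else 0, fun j hj => ?_⟩
  have := congrFun hx (f ⟨j, hj⟩)
  simp only [Matrix.mulVec, dotProduct, M, Matrix.of_apply, Equiv.symm_apply_apply] at this
  rw [← this, ← g.sum_comp, ← Finset.sum_subset hτ' (fun i _ hi => by simp [hi]),
    ← Finset.sum_coe_sort τ']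
  exact Finset.sum_congr rfl fun i _ => by simp

/-- The exceptional matrices form a proper real subspace, which is a null set. -/
lemma ae_inner_ne_zero {u : Fin KT → ℂ} (hu : u ≠ 0) (j : Fin KR) :
    ∀ᵐ h : ChannelMatrix KT KR, ∑ i, h j i * u i ≠ 0 := by
  classical
  let V : Submodule ℝ (ChannelMatrix KT KR) :=
    { carrier := {h | ∑ i, h j i * u i = 0}
      zero_mem' := by simp
      add_mem' := fun {a b} ha hb => by
        simp only [Set.mem_ofPred_eq, Pi.add_apply, add_mul, Finset.sum_add_distrib] at *
        rw [ha, hb, add_zero]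
      smul_mem' := fun c a ha => by
        simp only [Set.mem_ofPred_eq, Pi.smul_apply, smul_mul_assoc, ← Finset.smul_sum] at *
        rw [ha, smul_zero] }
  have hV : V ≠ ⊤ := by
    intro hV
    obtain ⟨i, hi⟩ := Function.ne_iff.1 hu
    have : (Pi.single j (Pi.single i 1) : ChannelMatrix KT KR) ∈ V := hV ▸ Submodule.mem_top
    change ∑ k, (Pi.single j (Pi.single i 1) : ChannelMatrix KT KR) j k * u k = 0 at this
    simp [Pi.single_apply] at this
    exact hi this
  have := Measure.addHaar_submodule volume V hV
  exact (measure_eq_zero_iff_ae_notMem).1 this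

end Generic

/-! ### Decoding in terms of gains -/

section Gain

variable {KT KR N F : ℕ}

/-- The coefficient with which the symbol of `p` reaches receiver `j`. -/
def gain (C : Placement KT KR N F) (h : ChannelMatrix KT KR) (v : Fin KT → Packet N F → ℂ)
    (j : Fin KR) (p : Packet N F) : ℂ :=
  ∑ i with p ∈ C.tx i, h j i * v i p

lemma rxSignal_txSignal (γ P : ℝ) (C : Placement KT KR N F) (b : Block KR N F)
    (h : ChannelMatrix KT KR) (v : Fin KT → Packet N F → ℂ) (w : Packet N F → ℂ) (z : ℂ)
    (j : Fin KR) :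
    rxSignal γ P h (txSignal C b v w) z j
      = (Real.sqrt (P ^ γ) : ℂ) * ∑ p ∈ b.packets, gain C h v j p * w p + z := by
  classical
  unfold rxSignal txSignal gain
  congr 2
  simp only [Finset.mul_sum, Finset.sum_mul, Finset.sum_filter, Finset.inter_comm (C.tx _),
    ← Finset.filter_mem_eq_inter]
  rw [Finset.sum_comm]
  refine Finset.sum_congr rfl fun p _ => Finset.sum_congr rfl fun i _ => ?_
  split_ifs <;> ring

/-- Side information removes exactly the cached symbols, so every other unwanted symbol must already
arrive with coefficient zero. Necessity follows by comparing coefficients at `P = 1` without noise.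
-/
lemma recovers_iff {γ : ℝ} {C : Placement KT KR N F} {b : Block KR N F}
    {h : ChannelMatrix KT KR} {v : Fin KT → Packet N F → ℂ} {j : Fin KR}
    (hj : j ∈ b.served) (hmiss : b.target j ∉ C.rx j) :
    Recovers γ C b h v j ↔ gain C h v j (b.target j) ≠ 0 ∧
      ∀ p ∈ b.packets, p ≠ b.target j → p ∉ C.rx j → gain C h v j p = 0 := by
  classical
  have hmem : b.target j ∈ b.packets := Finset.mem_image_of_mem _ hj
  constructor
  · rintro ⟨g, hg, H⟩
    obtain ⟨a, ha⟩ := H 1 one_pos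
    have key : ∀ p ∈ b.packets, p ∉ C.rx j →
        gain C h v j p = g * (Pi.single p 1 : Packet N F → ℂ) (b.target j) := by
      intro p hp hpj
      have := ha (Pi.single p 1) 0
      rw [rxSignal_txSignal] at this
      simpa [Pi.single_apply, hp, hpj] using this
    refine ⟨?_, fun p hp hne hpj => ?_⟩
    · rw [key _ hmem hmiss]; simpa
    · rw [key p hp hpj, Pi.single_eq_of_ne' hne, mul_zero]
  · rintro ⟨h0, hz⟩
    refine ⟨_, h0, fun P _ =>
      ⟨fun p => if p ∈ b.packets then -(Real.sqrt (P ^ γ) : ℂ) * gain C h v j p else 0,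
      fun w z => ?_⟩⟩
    rw [rxSignal_txSignal]
    have e1 : ∑ p ∈ b.packets, gain C h v j p * w p
        = gain C h v j (b.target j) * w (b.target j)
          + ∑ p ∈ C.rx j, if p ∈ b.packets then gain C h v j p * w p else 0 := by
      rw [← Finset.add_sum_erase _ _ hmem, ← Finset.sum_filter, Finset.filter_mem_eq_inter]
      congr 1
      refine (Finset.sum_subset (fun p hp => ?_) fun p hp hp' => ?_).symm
      · rw [Finset.mem_inter] at hp
        exact Finset.mem_erase.2 ⟨fun e => hmiss (e ▸ hp.1), hp.2⟩
      · rw [Finset.mem_erase] at hp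
        rw [hz p hp.2 hp.1 fun h' => hp' (Finset.mem_inter.2 ⟨h', hp.2⟩), zero_mul]
    rw [e1, mul_add, Finset.mul_sum, add_assoc, add_assoc, add_comm z, ← add_assoc (∑ i ∈ _, _),
      ← Finset.sum_add_distrib, Finset.sum_eq_zero, zero_add]
    intro p _
    by_cases hp : p ∈ b.packets
    · simp only [hp, if_true]; ring
    · simp [hp]

end Gain

/-! ### Which blocks are feasible -/

section Feasible

variable {KT KR N F : ℕ} {Ω : Type*} [MeasurableSpace Ω]

/-- The served receivers other than `j` that have not cached the packet intended for `j`. -/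
def unaware (C : Placement KT KR N F) (b : Block KR N F) (j : Fin KR) : Finset (Fin KR) :=
  b.served.filter fun j' => j' ≠ j ∧ b.target j ∉ C.rx j'

lemma card_served_le_unaware (C : Placement KT KR N F) (b : Block KR N F) (j : Fin KR) :
    b.served.card ≤ (unaware C b j).card + 1
      + (Finset.univ.filter fun j' => b.target j ∈ C.rx j').card := by
  classical
  have : b.served ⊆ unaware C b j ∪ {j} ∪ Finset.univ.filter fun j' => b.target j ∈ C.rx j' := by
    intro j' hj'
    simp only [unaware, Finset.mem_union, Finset.mem_filter, Finset.mem_singleton,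
      Finset.mem_univ, true_and]
    tauto
  refine (Finset.card_le_card this).trans ((Finset.card_union_le _ _).trans ?_)
  gcongr
  exact Finset.card_union_le _ _

lemma Success.gain_unaware {γ : ℝ} {C : Placement KT KR N F} {b : Block KR N F}
    {h : ChannelMatrix KT KR} {v : Fin KT → Packet N F → ℂ} (hs : Success γ C b h v)
    (hmiss : ∀ j ∈ b.served, b.target j ∉ C.rx j) {j : Fin KR} (hj : j ∈ b.served) :
    gain C h v j (b.target j) ≠ 0 ∧ ∀ j' ∈ unaware C b j, gain C h v j' (b.target j) = 0 := by
  refine ⟨((recovers_iff hj (hmiss j hj)).1 (hs.2 j hj)).1, fun j' hj' => ?_⟩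
  simp only [unaware, Finset.mem_filter] at hj'
  exact ((recovers_iff hj'.1 (hmiss j' hj'.1)).1 (hs.2 j' hj'.1)).2 _
    (Finset.mem_image_of_mem _ hj) (fun e => hj'.2.1 (b.inj hj'.1 hj e.symm)) hj'.2.2

lemma Network.ae_hP (net : Network KT KR Ω) {p : ChannelMatrix KT KR → Prop}
    (hp : ∀ᵐ h, p h) : ∀ᵐ ω ∂net.law, ∀ t, p (net.hP t ω) :=
  ae_all_iff.2 fun t => ae_of_ae_map (net.measurable_hP t).aemeasurable
    ((net.continuous_hP t).ae_le hp)

lemma Network.ae_hN (net : Network KT KR Ω) {p : ChannelMatrix KT KR → Prop}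
    (hp : ∀ᵐ h, p h) : ∀ᵐ ω ∂net.law, ∀ t, p (net.hN t ω) :=
  ae_all_iff.2 fun t => ae_of_ae_map (net.measurable_hN t).aemeasurable
    ((net.continuous_hN t).ae_le hp)

lemma self_mem_blockTimes {B : ℕ} (hB : 0 < B) (m : ℕ) : m * B ∈ blockTimes B m :=
  Finset.mem_Ico.2 ⟨le_rfl, Nat.mul_lt_mul_of_pos_right m.lt_succ_self hB⟩

/-- With perfect CSIT a block serves at most as many receivers as there are nodes that have cached
any given packet of it. -/
lemma PFeasible.card_served_le {net : Network KT KR Ω} {C : Placement KT KR N F} {q : ℝ} {m : ℕ}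
    {b : Block KR N F} (hf : PFeasible net C q m b)
    (hmiss : ∀ j ∈ b.served, b.target j ∉ C.rx j) {j : Fin KR} (hj : j ∈ b.served) :
    b.served.card ≤ (Finset.univ.filter fun i => b.target j ∈ C.tx i).card
      + (Finset.univ.filter fun j' => b.target j ∈ C.rx j').card := by
  have := net.isProb
  obtain ⟨ω, hω, hgen⟩ := (hf.and (net.ae_hP ae_generic)).exists
  obtain ⟨v, hv⟩ := hω _ (self_mem_blockTimes (net.lenP_pos q) m)
  obtain ⟨h0, hz⟩ := hv.gain_unaware hmiss hj
  by_contra! hlt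
  have hcard := card_served_le_unaware C b j
  -- There are at least as many nulling equations as transmitters holding the packet, so its beam
  -- vanishes, also at `j`.
  refine h0 (Finset.sum_eq_zero fun i hi => ?_)
  rw [(hgen _).eq_zero (by omega) hz i hi, mul_zero]

/-- Without CSIT a block serves at most one more receiver than there are receivers that have cached
any given packet of it. -/
lemma NFeasible.card_served_le {net : Network KT KR Ω} {C : Placement KT KR N F} {q : ℝ} {m : ℕ}
    {b : Block KR N F} (hf : NFeasible net C q m b)
    (hmiss : ∀ j ∈ b.served, b.target j ∉ C.rx j) {j : Fin KR} (hj : j ∈ b.served) :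
    b.served.card ≤ 1 + (Finset.univ.filter fun j' => b.target j ∈ C.rx j').card := by
  classical
  have := net.isProb
  by_contra! hlt
  have hcard := card_served_le_unaware C b j
  obtain ⟨j', hj'⟩ : (unaware C b j).Nonempty := Finset.card_pos.1 (by omega)
  obtain ⟨v, hmeas, hind, hsucc⟩ := hf
  set t := m * net.lenN q
  set p := b.target j
  -- The effective beam of `p`, a measurable function of `v` and hence independent of the channel.
  let U : Ω → Fin KT → ℂ := fun ω i => if p ∈ C.tx i then v t ω i p else 0
  have hUm : Measurable U := by
    refine measurable_pi_lambda _ fun i => ?_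
    by_cases hi : p ∈ C.tx i
    · simp only [U, hi, if_true]
      exact (measurable_pi_apply p).comp ((measurable_pi_apply i).comp (hmeas t))
    · simp [U, hi]
  have hUind : IndepFun U (net.hN t) net.law := by
    have h1 : Measurable fun (V : ℕ → Fin KT → Packet N F → ℂ) (i : Fin KT) =>
        if p ∈ C.tx i then V t i p else 0 := by
      refine measurable_pi_lambda _ fun i => ?_
      by_cases hi : p ∈ C.tx i
      · simp only [hi, if_true]
        fun_prop
      · simp [hi]
    exact hind.comp h1 (measurable_pi_apply t)
  have hgain : ∀ ω k, gain C (net.hN t ω) (v t ω) k p = ∑ i, net.hN t ω k i * U ω i := by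
    intro ω k
    simp only [gain, Finset.sum_filter, U, mul_ite, mul_zero]
  let s : Set ((Fin KT → ℂ) × ChannelMatrix KT KR) :=
    {x | x.1 = 0 ∨ ∑ i, x.2 j' i * x.1 i ≠ 0}
  have hs : MeasurableSet s := by
    refine (measurable_fst (measurableSet_singleton 0)).union (MeasurableSet.compl ?_)
    exact measurableSet_eq_fun (by fun_prop) measurable_const
  -- By independence the joint law is a product; for each fixed nonzero beam the bad channels are
  -- null.
  have hprod : ∀ᵐ x ∂net.law.map (fun ω => (U ω, net.hN t ω)), x ∈ s := by
    rw [hUind.map_prod_eq_prod_map_map hUm.aemeasurable (net.measurable_hN t).aemeasurable]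
    have := Measure.isProbabilityMeasure_map (μ := net.law) (net.measurable_hN t).aemeasurable
    rw [Measure.ae_prod_mem_iff_ae_ae_mem hs]
    refine Filter.Eventually.of_forall fun u => ?_
    by_cases hu : u = 0
    · exact Filter.Eventually.of_forall fun h => Or.inl hu
    · have hne : ∀ᵐ h ∂net.law.map (net.hN t), ∑ i, h j' i * u i ≠ 0 :=
        (net.continuous_hN t).ae_le (ae_inner_ne_zero hu j')
      exact hne.mono fun h hh => Or.inr hh
  obtain ⟨ω, hω, hω'⟩ := ((ae_of_ae_map (hUm.prodMk (net.measurable_hN t)).aemeasurable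
    hprod).and hsucc).exists
  obtain ⟨h0, hz⟩ := (hω' t (self_mem_blockTimes (net.lenN_pos q) m)).gain_unaware hmiss hj
  rw [hgain] at h0
  rcases hω with h | h
  · exact h0 (by simp only at h; simp [h])
  · exact h (by rw [← hgain]; exact hz j' hj')

/-- A block is feasible with perfect CSIT if every packet of it can be zero-forced at the served
receivers that have not cached it. -/
lemma pFeasible_of_unaware {net : Network KT KR Ω} {C : Placement KT KR N F} {q : ℝ} {m : ℕ}
    {b : Block KR N F} (hmiss : ∀ j ∈ b.served, b.target j ∉ C.rx j)
    (hcard : ∀ j ∈ b.served, (unaware C b j).card + 1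
      ≤ (Finset.univ.filter fun i => b.target j ∈ C.tx i).card) :
    PFeasible net C q m b := by
  classical
  filter_upwards [net.ae_hP ae_generic] with ω hω t _
  set h := net.hP t ω
  -- Unit gain at the intended receiver, zero at the unaware ones. Since `target` is injective on
  -- served receivers, the beam can be chosen per packet.
  have hu : ∀ p : Packet N F, ∃ u : Fin KT → ℂ, ∀ j ∈ b.served, b.target j = p →
      ∀ k ∈ insert j (unaware C b j), ∑ i with p ∈ C.tx i, h k i * u i = if k = j then 1 else 0 := by
    intro p
    by_cases hp : ∃ j ∈ b.served, b.target j = p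
    · obtain ⟨j, hj, rfl⟩ := hp
      obtain ⟨u, hu⟩ := (hω t).exists_solution
        ((Finset.card_insert_le j (unaware C b j)).trans (hcard j hj))
        fun k => if k = j then 1 else 0
      refine ⟨u, fun j' hj' e => ?_⟩
      rw [b.inj hj' hj e]
      exact hu
    · exact ⟨0, fun j hj e => (hp ⟨j, hj, e⟩).elim⟩
  choose u hu using hu
  -- Scaling to meet the power constraint: with total power `s`, `c ≤ 1` gives `c² s ≤ c (1 + s) =
  -- 1`.
  let c : ℝ := (1 + ∑ i, ∑ p ∈ b.packets, ‖u p i‖ ^ 2)⁻¹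
  have hsum : 0 ≤ ∑ i, ∑ p ∈ b.packets, ‖u p i‖ ^ 2 := by positivity
  have hc : 0 < c := by positivity
  have hc1 : c ≤ 1 := inv_le_one_of_one_le₀ (by linarith)
  have hg : ∀ j ∈ b.served, ∀ k ∈ insert j (unaware C b j),
      gain C h (fun i p => c * u p i) k (b.target j) = if k = j then (c : ℂ) else 0 := by
    intro j hj k hk
    simp only [gain, mul_left_comm _ (c : ℂ), ← Finset.mul_sum]
    rw [hu _ j hj rfl k hk]
    split_ifs <;> simp
  refine ⟨fun i p => c * u p i, fun i => ?_, fun j hj => ?_⟩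
  · simp only [norm_mul, mul_pow, ← Finset.mul_sum, Complex.norm_real, Real.norm_eq_abs, sq_abs]
    have h1 : ∑ p ∈ C.tx i ∩ b.packets, ‖u p i‖ ^ 2 ≤ ∑ i, ∑ p ∈ b.packets, ‖u p i‖ ^ 2 :=
      (Finset.sum_le_sum_of_subset_of_nonneg Finset.inter_subset_right
        fun _ _ _ => by positivity).trans
      (Finset.single_le_sum (f := fun i => ∑ p ∈ b.packets, ‖u p i‖ ^ 2)
        (fun _ _ => by positivity) (Finset.mem_univ i))
    calc c ^ 2 * ∑ p ∈ C.tx i ∩ b.packets, ‖u p i‖ ^ 2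
        ≤ c * (1 + ∑ i, ∑ p ∈ b.packets, ‖u p i‖ ^ 2) := by
          gcongr
          · nlinarith
          · linarith
      _ = 1 := inv_mul_cancel₀ (by positivity)
  · rw [recovers_iff hj (hmiss j hj)]
    constructor
    · rw [hg j hj j (Finset.mem_insert_self _ _), if_pos rfl]
      exact_mod_cast hc.ne'
    · intro p hp hne hpj
      obtain ⟨j', hj', rfl⟩ := Finset.mem_image.1 hp
      have hjj : j ≠ j' := fun e => hne (e ▸ rfl)
      rw [hg j' hj' j (Finset.mem_insert_of_mem (Finset.mem_filter.2 ⟨hj, hjj, hpj⟩)), if_neg hjj]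

/-- A block is feasible without CSIT if every packet of it is known at all other served receivers. -/
lemma nFeasible_of_unaware {net : Network KT KR Ω} {C : Placement KT KR N F} {q : ℝ} {m : ℕ}
    {b : Block KR N F} (hmiss : ∀ j ∈ b.served, b.target j ∉ C.rx j)
    (hun : ∀ j ∈ b.served, unaware C b j = ∅)
    (htx : ∀ j ∈ b.served, ∃ i, b.target j ∈ C.tx i) :
    NFeasible net C q m b := by
  classical
  have := net.isProb
  let c : ℝ := (1 + b.packets.card : ℝ)⁻¹
  have hc : 0 < c := by positivity
  have hc1 : c ≤ 1 := inv_le_one_of_one_le₀ (by simp)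
  -- Nothing has to be nulled, so constant beamformers suffice, and these are trivially independent
  -- of the channel.
  refine ⟨fun _ _ _ _ => c, fun _ => measurable_const, indepFun_const_left _ _, ?_⟩
  have hne : ∀ᵐ h : ChannelMatrix KT KR, ∀ j ∈ b.served,
      ∑ i, h j i * (if b.target j ∈ C.tx i then (c : ℂ) else 0) ≠ 0 := by
    refine (ae_ball_iff b.served.countable_toSet).2 fun j hj => ?_
    refine ae_inner_ne_zero (u := fun i => if b.target j ∈ C.tx i then (c : ℂ) else 0) ?_ j
    obtain ⟨i, hi⟩ := htx j hj
    refine Function.ne_iff.2 ⟨i, ?_⟩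
    simp [hi, hc.ne']
  filter_upwards [net.ae_hN hne] with ω hω t _
  refine ⟨fun i => ?_, fun j hj => ?_⟩
  · simp only [Finset.sum_const, Complex.norm_real, Real.norm_eq_abs, sq_abs, nsmul_eq_mul]
    have h1 : ((C.tx i ∩ b.packets).card : ℝ) ≤ 1 + b.packets.card := by
      have := Finset.card_le_card (Finset.inter_subset_right (s₁ := C.tx i) (s₂ := b.packets))
      have : ((C.tx i ∩ b.packets).card : ℝ) ≤ b.packets.card := by exact_mod_cast this
      linarith
    calc ((C.tx i ∩ b.packets).card : ℝ) * c ^ 2 ≤ (1 + b.packets.card) * c := by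
          gcongr
          nlinarith
      _ = 1 := mul_inv_cancel₀ (by positivity)
  · rw [recovers_iff hj (hmiss j hj)]
    constructor
    · have := hω t j hj
      simpa only [gain, Finset.sum_filter, mul_ite, mul_zero] using this
    · intro p hp hne hpj
      obtain ⟨j', hj', rfl⟩ := Finset.mem_image.1 hp
      have : j ∈ unaware C b j' := Finset.mem_filter.2 ⟨hj, fun e => hne (e ▸ rfl), hpj⟩
      rw [hun j' hj'] at this
      simp at this

end Feasible

/-! ### Counting blocks and averaging over constant demands -/

section Converse

variable {KT KR N F : ℕ}

/-- The number of receivers that have cached `p`. -/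
def rxCount (C : Placement KT KR N F) (p : Packet N F) : ℕ :=
  (Finset.univ.filter fun j => p ∈ C.rx j).card

/-- The number of transmitters that have cached `p`. -/
def txCount (C : Placement KT KR N F) (p : Packet N F) : ℕ :=
  (Finset.univ.filter fun i => p ∈ C.tx i).card

lemma sum_rxCount (C : Placement KT KR N F) : ∑ p, rxCount C p = ∑ j, (C.rx j).card := by
  simp only [rxCount, Finset.card_eq_sum_ones, Finset.sum_filter]
  rw [Finset.sum_comm]
  simp

lemma sum_txCount (C : Placement KT KR N F) : ∑ p, txCount C p = ∑ i, (C.tx i).card := by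
  simp only [txCount, Finset.card_eq_sum_ones, Finset.sum_filter]
  rw [Finset.sum_comm]
  simp

lemma sum_const_demands (C : Placement KT KR N F) (f : Packet N F → ℝ) :
    ∑ n : Fin N, ∑ j, ∑ p ∈ missing C (fun _ => n) j, f p
      = ∑ p, ((KR : ℝ) - rxCount C p) * f p := by
  have h1 : ∀ p, ∑ j : Fin KR, (if p ∉ C.rx j then f p else 0)
      = ((KR : ℝ) - rxCount C p) * f p := by
    intro p
    have hc : (Finset.univ.filter fun j => p ∈ C.rx j).card
        + (Finset.univ.filter fun j => p ∉ C.rx j).card = KR := by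
      rw [Finset.card_filter_add_card_filter_not, Finset.card_univ, Fintype.card_fin]
    have hc' : ((Finset.univ.filter fun j => p ∈ C.rx j).card : ℝ)
        + (Finset.univ.filter fun j => p ∉ C.rx j).card = KR := by exact_mod_cast hc
    rw [← Finset.sum_filter, Finset.sum_const, nsmul_eq_mul, rxCount]
    congr 1
    linarith
  simp only [← h1, missing, Finset.sum_filter]
  rw [Finset.sum_comm, Finset.sum_comm (s := (Finset.univ : Finset (Packet N F)))]
  refine Finset.sum_congr rfl fun j _ => ?_
  rw [Finset.sum_comm]
  refine Finset.sum_congr rfl fun p _ => ?_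
  by_cases hp : p ∈ C.rx j <;> simp [hp]

/-- If a block with packet `p` serves at most `ℓ p` receivers, then at least
`∑ 1 / ℓ p` blocks are needed; here `1 / ℓ p` is bounded from below by a tangent. -/
lemma Delivers.sum_le {feasible : ℕ → Block KR N F → Prop} {C : Placement KT KR N F}
    {d : Fin KR → Fin N} {H : ℕ} {b : Fin H → Block KR N F} (hb : Delivers feasible C d b)
    {ℓ : Packet N F → ℝ} (hℓ : ∀ m, ∀ j ∈ (b m).served,
      ((b m).served.card : ℝ) ≤ ℓ ((b m).target j)) {c : ℝ} (hc : 0 < c) :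
    ∑ j, ∑ p ∈ missing C d j, (2 / c - ℓ p / c ^ 2) ≤ (H : ℝ) := by
  classical
  -- Each block shares one unit equally among its served receivers. A linear lower bound for a share
  -- makes only the mean of `ℓ` matter later.
  let g : Fin H → Fin KR → Packet N F → ℝ := fun m j p =>
    if j ∈ (b m).served ∧ (b m).target j = p then ((b m).served.card : ℝ)⁻¹ else 0
  have hg : ∀ m j p, 0 ≤ g m j p := fun m j p => by
    dsimp only [g]
    split_ifs <;> positivity
  have h1 : ∀ j, ∀ p ∈ missing C d j, 2 / c - ℓ p / c ^ 2 ≤ ∑ m, g m j p := by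
    intro j p hp
    obtain ⟨m, hj, hm⟩ := hb.2.2 j p hp
    refine le_trans ?_ (Finset.single_le_sum (fun m _ => hg m j p) (Finset.mem_univ m))
    have hl := hℓ m j hj
    have hpos : (0 : ℝ) < (b m).served.card := by exact_mod_cast Finset.card_pos.2 ⟨j, hj⟩
    simp only [g, hj, hm, and_self, if_true] at hl ⊢
    set l : ℝ := ((b m).served.card : ℝ)
    have h2 : l⁻¹ - (2 / c - l / c ^ 2) = (l - c) ^ 2 / (l * c ^ 2) := by
      field_simp
      ring
    have h3 : 0 ≤ (l - c) ^ 2 / (l * c ^ 2) := by positivity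
    have h4 : l / c ^ 2 ≤ ℓ p / c ^ 2 := by gcongr
    linarith
  calc ∑ j, ∑ p ∈ missing C d j, (2 / c - ℓ p / c ^ 2)
      ≤ ∑ j, ∑ p ∈ missing C d j, ∑ m, g m j p :=
        Finset.sum_le_sum fun j _ => Finset.sum_le_sum fun p hp => h1 j p hp
    _ ≤ ∑ j, ∑ p, ∑ m, g m j p :=
        Finset.sum_le_sum fun j _ => Finset.sum_le_sum_of_subset_of_nonneg
          (Finset.subset_univ _) fun p _ _ => Finset.sum_nonneg fun m _ => hg m j p
    _ = ∑ m, ∑ j, ∑ p, g m j p := by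
        simp only [Finset.sum_comm (t := (Finset.univ : Finset (Fin H)))]
    _ ≤ ∑ _m : Fin H, (1 : ℝ) := by
        refine Finset.sum_le_sum fun m _ => ?_
        have h5 : ∀ j, ∑ p, g m j p
            = if j ∈ (b m).served then ((b m).served.card : ℝ)⁻¹ else 0 := by
          intro j
          by_cases hj : j ∈ (b m).served <;> simp [g, hj]
        simp only [h5, Finset.sum_ite_mem, Finset.univ_inter, Finset.sum_const, nsmul_eq_mul]
        -- An inequality, because a block may serve nobody.
        exact mul_inv_le_one
    _ = H := by simp

/-- Averaging over the constant demands: if every constant demand with missing packets can be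
delivered in `H` blocks with `y * H ≤ β * D`, and `c` dominates the average of the bounds `ℓ` on the
number of served receivers, then `y ≤ β * c`. -/
lemma rate_le {C : Placement KT KR N F} {y β c : ℝ} (hy : 0 ≤ y) (hc : 0 < c)
    {ℓ : Packet N F → ℝ}
    (H : ∀ n : Fin N, 0 < numMissing C (fun _ => n) → ∃ (feasible : ℕ → Block KR N F → Prop)
      (H : ℕ) (b : Fin H → Block KR N F), Delivers feasible C (fun _ => n) b ∧
      (∀ m, ∀ j ∈ (b m).served, ((b m).served.card : ℝ) ≤ ℓ ((b m).target j)) ∧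
      y * H ≤ β * numMissing C (fun _ => n))
    (hW : 0 < ∑ p, ((KR : ℝ) - rxCount C p))
    (hM : ∑ p, ((KR : ℝ) - rxCount C p) * ℓ p ≤ c * ∑ p, ((KR : ℝ) - rxCount C p)) :
    y ≤ β * c := by
  have h1 : ∀ n : Fin N, y * ∑ j, ∑ p ∈ missing C (fun _ => n) j, (2 / c - ℓ p / c ^ 2)
      ≤ β * ∑ j, ∑ p ∈ missing C (fun _ => n) j, (1 : ℝ) := by
    intro n
    have hnum : (∑ j, ∑ p ∈ missing C (fun _ => n) j, (1 : ℝ)) = numMissing C (fun _ => n) := by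
      simp [numMissing]
    rcases Nat.eq_zero_or_pos (numMissing C fun _ => n) with h0 | h0
    · have he : ∀ j, missing C (fun _ => n) j = ∅ := by
        simpa [numMissing] using h0
      simp [he]
    · obtain ⟨feas, H, b, hb, hℓ, hyH⟩ := H n h0
      rw [hnum]
      exact (mul_le_mul_of_nonneg_left (Delivers.sum_le hb hℓ hc) hy).trans hyH
  have h2 := Finset.sum_le_sum fun n (_ : n ∈ Finset.univ) => h1 n
  rw [← Finset.mul_sum, ← Finset.mul_sum, sum_const_demands, sum_const_demands] at h2
  simp only [mul_one, mul_sub, Finset.sum_sub_distrib] at h2 hW hM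
  have e1 : ∀ p : Packet N F, ((KR : ℝ) - rxCount C p) * (ℓ p / c ^ 2)
      = ((KR : ℝ) - rxCount C p) * ℓ p / c ^ 2 := fun p => (mul_div_assoc _ _ _).symm
  simp only [e1, ← Finset.sum_div, ← Finset.sum_mul, Finset.sum_sub_distrib] at h2
  rw [← mul_sub] at hM
  set W : ℝ := ∑ _p : Packet N F, (KR : ℝ) - ∑ p, (rxCount C p : ℝ)
  set M := ∑ p, ((KR : ℝ) - rxCount C p) * ℓ p
  -- Of the tangent term `2 W / c`, at least `W / c` survives.
  have h3 : M / c ^ 2 ≤ W / c := by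
    rw [div_le_div_iff₀ (by positivity) hc]
    nlinarith
  have h4 : y * (W / c) ≤ β * W := by
    rw [← mul_sub, ← mul_sub] at h2
    refine le_trans (mul_le_mul_of_nonneg_left ?_ hy) h2
    have : W * (2 / c) = W / c + W / c := by ring
    linarith
  have h5 : y * W ≤ β * c * W := by
    calc y * W = c * (y * (W / c)) := by field_simp
      _ ≤ c * (β * W) := by gcongr
      _ = β * c * W := by ring
  exact le_of_mul_le_mul_right h5 hW

end Converse

/-- Clears the extended-real denominators. For `α = 0` a positive `q * H` would make the time
infinite and the rate zero. -/
lemma mul_le_of_le_div_deliveryTime {x q α : ℝ} {D H : ℕ} {T : ℝ≥0∞} (hx : 0 < x) (hq : 0 ≤ q)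
    (hα : 0 ≤ α) (h : ENNReal.ofReal x ≤ (D : ℝ≥0∞) / T)
    (hT : ENNReal.ofReal q / ENNReal.ofReal α * H ≤ T) : x * (q * H) ≤ α * D := by
  have h1 : ENNReal.ofReal x * (ENNReal.ofReal q / ENNReal.ofReal α * H) ≤ D :=
    (mul_le_mul_right hT _).trans (ENNReal.mul_le_of_le_div h)
  rcases hα.eq_or_lt with rfl | hα
  · rcases hq.eq_or_lt with rfl | hq
    · simp
    rcases Nat.eq_zero_or_pos H with rfl | hH
    · simp
    rw [ENNReal.ofReal_zero, ENNReal.div_zero (by simpa using hq),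
      ENNReal.top_mul (by exact_mod_cast hH.ne'), ENNReal.mul_top (by simpa using hx)] at h1
    exact absurd h1 (by simp)
  · rw [← ENNReal.ofReal_div_of_pos hα, ← ENNReal.ofReal_natCast H, ← ENNReal.ofReal_natCast D,
      ← ENNReal.ofReal_mul (by positivity), ← ENNReal.ofReal_mul hx.le,
      ENNReal.ofReal_le_ofReal_iff (by positivity)] at h1
    calc x * (q * H) = α * (x * (q / α * H)) := by field_simp
      _ ≤ α * D := by gcongr

/-! ### The upper bound on the DoF -/

section Converse

variable {KT KR N F : ℕ} {Ω : Type*} [MeasurableSpace Ω]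

lemma dofOf_le (net : Network KT KR Ω) {C : Placement KT KR N F} {q : ℝ} {S R : ℕ}
    (hN : 0 < N) (hF : 0 < F) (hR : R < KR) (hS : 0 < S) (hq : q ∈ Set.Icc (0 : ℝ) 1)
    (htx : ∑ p, txCount C p = S * (N * F)) (hrx : ∑ p, rxCount C p = R * (N * F)) :
    dofOf net C q ≤ ENNReal.ofReal
      (net.α * (2 * min ((S : ℝ) + R) KR) + (1 - net.α) * (1 + R)) := by
  have hα := net.α_nonneg
  have hα1 := net.α_le_one
  have hS' : (1 : ℝ) ≤ S := by exact_mod_cast hS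
  have hK' : (R : ℝ) + 1 ≤ KR := by exact_mod_cast hR
  have hR0 : (0 : ℝ) ≤ R := R.cast_nonneg
  by_contra! hlt
  -- The supremum over deliveries need not be attained; any `x` strictly below it is reached for
  -- every demand.
  obtain ⟨x, -, hx, hxd⟩ := ENNReal.lt_iff_exists_real_btwn.1 hlt
  have hmin : 0 < min ((S : ℝ) + R) KR := lt_min (by linarith) (by linarith)
  have hB0 : 0 ≤ net.α * (2 * min ((S : ℝ) + R) KR) + (1 - net.α) * (1 + R) := by
    have : 0 ≤ 1 - net.α := by linarith
    positivity
  have hx' := (ENNReal.ofReal_lt_ofReal_iff_of_nonneg hB0).1 hx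
  have hx0 : 0 < x := hB0.trans_lt hx'
  have hdel : ∀ d, 0 < numMissing C d → ∃ (HP HN : ℕ) (bP : Fin HP → Block KR N F)
      (bN : Fin HN → Block KR N F), Delivers (PFeasible net C q) C d bP ∧
      Delivers (NFeasible net C q) C d bN ∧ x * (q * HP) ≤ net.α * numMissing C d ∧
      x * ((1 - q) * HN) ≤ (1 - net.α) * numMissing C d := by
    intro d hd
    have h1 := hxd.trans_le (iInf₂_le d hd)
    simp only [lt_iSup_iff] at h1
    obtain ⟨HP, HN, bP, bN, hP, hN, h1⟩ := h1
    exact ⟨HP, HN, bP, bN, hP, hN,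
      mul_le_of_le_div_deliveryTime hx0 hq.1 hα h1.le (le_max_left _ _),
      mul_le_of_le_div_deliveryTime hx0 (sub_nonneg.2 hq.2) (sub_nonneg.2 hα1) h1.le
        (le_max_right _ _)⟩
  set n : ℝ := (N : ℝ) * F with hn
  have hn0 : 0 < n := by positivity
  have hrx' : ∑ p, (rxCount C p : ℝ) = R * n := by
    rw [hn]; exact_mod_cast hrx
  have htx' : ∑ p, (txCount C p : ℝ) = S * n := by
    rw [hn]; exact_mod_cast htx
  have hcard : ∑ _p : Packet N F, (KR : ℝ) = KR * n := by
    simp [hn, mul_comm]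
  have hW : ∑ p, ((KR : ℝ) - rxCount C p) = (KR - R) * n := by
    rw [Finset.sum_sub_distrib, hcard, hrx']; ring
  have hW0 : 0 < ∑ p, ((KR : ℝ) - rxCount C p) := by
    rw [hW]
    exact mul_pos (by linarith) hn0
  -- Chebyshev's sum inequality, through the nonnegative variance of `rxCount` around its mean `R`.
  have hMr : ∑ p, ((KR : ℝ) - rxCount C p) * rxCount C p ≤ R * ((KR - R) * n) := by
    have h1 : 0 ≤ ∑ p, ((rxCount C p : ℝ) - R) ^ 2 := Finset.sum_nonneg fun _ _ => sq_nonneg _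
    have h2 : ∑ p, ((KR : ℝ) - rxCount C p) * rxCount C p
        = ∑ p, (((KR : ℝ) - 2 * R) * rxCount C p - ((rxCount C p : ℝ) - R) ^ 2)
          + ∑ _p : Packet N F, (R : ℝ) ^ 2 := by
      rw [← Finset.sum_add_distrib]
      exact Finset.sum_congr rfl fun p _ => by ring
    have h3 : ∑ _p : Packet N F, (R : ℝ) ^ 2 = R ^ 2 * n := by
      simp [hn, mul_comm]
    rw [h2, h3, Finset.sum_sub_distrib, ← Finset.mul_sum, hrx']
    nlinarith
  have hMs : ∑ p, ((KR : ℝ) - rxCount C p) * txCount C p ≤ KR * (S * n) := by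
    rw [← htx', Finset.mul_sum]
    refine Finset.sum_le_sum fun p _ => mul_le_mul_of_nonneg_right ?_ (Nat.cast_nonneg _)
    linarith [(rxCount C p).cast_nonneg (α := ℝ)]
  have hmissing : ∀ {d : Fin KR → Fin N} {H : ℕ} {b : Fin H → Block KR N F}
      {feas : ℕ → Block KR N F → Prop}, Delivers feas C d b →
      ∀ m, ∀ j ∈ (b m).served, (b m).target j ∉ C.rx j := fun hb m j hj =>
    (Finset.mem_filter.1 (hb.2.1 m j hj)).2.2
  have hNrate : x * (1 - q) ≤ (1 - net.α) * (1 + R) := by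
    refine rate_le (ℓ := fun p => 1 + rxCount C p) (mul_nonneg hx0.le (sub_nonneg.2 hq.2))
      (by positivity) (fun n hd => ?_) hW0 ?_
    · obtain ⟨_, HN, _, bN, -, hbN, -, h⟩ := hdel _ hd
      refine ⟨_, HN, bN, hbN, fun m j hj => ?_, by rwa [mul_assoc]⟩
      exact_mod_cast (hbN.1 m).card_served_le (hmissing hbN m) hj
    · simp only [mul_add, mul_one, Finset.sum_add_distrib]
      rw [hW]
      linarith
  have hPrate : x * q ≤ net.α * KR := by
    refine rate_le (ℓ := fun p => KR) (mul_nonneg hx0.le hq.1)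
      (by linarith) (fun n hd => ?_) hW0 ?_
    · obtain ⟨HP, _, bP, _, hbP, -, h, -⟩ := hdel _ hd
      refine ⟨_, HP, bP, hbP, fun m j hj => ?_, by rwa [mul_assoc]⟩
      exact_mod_cast (Finset.card_le_univ _).trans_eq (Fintype.card_fin KR)
    · rw [← Finset.sum_mul, mul_comm]
  have hPrate' : x * q ≤ net.α * (2 * (S + R)) := by
    -- If receivers cache at least half the library, the trivial bound `KR` is good enough;
    -- otherwise `KR ≤ 2 (KR - R)` absorbs the crude weight `KR` of `hMs`.
    rcases le_total (KR : ℝ) (2 * R) with h2R | h2R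
    · refine hPrate.trans (mul_le_mul_of_nonneg_left ?_ hα)
      linarith
    refine rate_le (ℓ := fun p => txCount C p + rxCount C p) (mul_nonneg hx0.le hq.1)
      (by linarith) (fun n hd => ?_) hW0 ?_
    · obtain ⟨HP, _, bP, _, hbP, -, h, -⟩ := hdel _ hd
      refine ⟨_, HP, bP, hbP, fun m j hj => ?_, by rwa [mul_assoc]⟩
      exact_mod_cast (hbP.1 m).card_served_le (hmissing hbP m) hj
    · simp only [mul_add, Finset.sum_add_distrib]
      rw [hW]
      have h1 : KR * (S * n) ≤ 2 * (KR - R) * (S * n) := by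
        gcongr
        linarith
      have h2 : 0 ≤ R * ((KR - R) * n) := mul_nonneg hR0 (mul_nonneg (by linarith) hn0.le)
      linarith
  have hPmin : x * q ≤ net.α * (2 * min ((S : ℝ) + R) KR) := by
    rcases min_cases ((S : ℝ) + R) KR with ⟨h, -⟩ | ⟨h, -⟩
    · rwa [h]
    · rw [h]
      exact hPrate.trans (mul_le_mul_of_nonneg_left (by linarith) hα)
  linarith

lemma dofStar_div_two_le (net : Network KT KR Ω) {μT μR : ℝ} {S R : ℕ}
    (hN : 0 < N) (hF : 0 < F) (hR : R < KR) (hS : 0 < S)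
    (hμT : KT * μT = S) (hμR : KR * μR = R) :
    dofStar net N F μT μR / 2 ≤ ENNReal.ofReal (dofCentralized KT KR μT μR net.α) := by
  refine ENNReal.div_le_of_le_mul (iSup_le fun C => iSup_le fun q => iSup_le fun hC =>
    iSup_le fun hq => ?_)
  have htx : ∑ p, txCount C p = S * (N * F) := by
    rw [sum_txCount]
    have : (∑ i, ((C.tx i).card : ℝ)) = S * (N * F) := by
      simp [hC.1, ← hμT]
      ring
    exact_mod_cast this
  have hrx : ∑ p, rxCount C p = R * (N * F) := by
    rw [sum_rxCount]
    have : (∑ i, ((C.rx i).card : ℝ)) = R * (N * F) := by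
      simp [hC.2, ← hμR]
      ring
    exact_mod_cast this
  refine (dofOf_le net hN hF hR hS hq htx hrx).trans ?_
  have hK' : (R : ℝ) + 1 ≤ KR := by exact_mod_cast hR
  have hα1 : 0 ≤ 1 - net.α := sub_nonneg.2 net.α_le_one
  rw [← ENNReal.ofReal_ofNat 2, ← ENNReal.ofReal_mul' zero_le_two, dofCentralized, hμT, hμR]
  refine ENNReal.ofReal_le_ofReal ?_
  rw [min_eq_left (by linarith : (1 : ℝ) + R ≤ KR)]
  have : 0 ≤ (1 - net.α) * (1 + R) := by positivity
  linarith

end Converse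

/-! ### The symmetric placement and its blocks -/

section Scheme

lemma card_perm_lt {K A : ℕ} (hA : A ≤ K) (σ : Equiv.Perm (Fin K)) :
    (Finset.univ.filter fun j => (σ j : ℕ) < A).card = A := by
  have : (Finset.univ.filter fun j => (σ j : ℕ) < A)
      = (Finset.univ.filter fun j : Fin K => (j : ℕ) < A).map σ.symm.toEmbedding := by
    ext j
    simp [Finset.mem_map_equiv]
  rw [this, Finset.card_map, Fin.card_filter_val_lt, min_eq_right hA]

/-- Composing with a transposition shows that all nodes cache equally many packets; double counting
then gives the number. -/
lemma card_filter_perm_lt {α Y : Type*} [Fintype α] {K R : ℕ} (hR : R ≤ K)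
    (φ : α ≃ Equiv.Perm (Fin K) × Y) (j : Fin K) :
    K * (Finset.univ.filter fun p => ((φ p).1 j : ℕ) < R).card = R * Fintype.card α := by
  classical
  have h1 : ∀ j', (Finset.univ.filter fun p => ((φ p).1 j' : ℕ) < R).card
      = (Finset.univ.filter fun p => ((φ p).1 j : ℕ) < R).card := by
    intro j'
    let e : α ≃ α := (φ.trans ((Equiv.mulRight (Equiv.swap j j')).prodCongr (Equiv.refl Y))).trans
      φ.symm
    refine Finset.card_equiv e fun p => ?_
    simp [e]
  have h2 : ∑ j', (Finset.univ.filter fun p => ((φ p).1 j' : ℕ) < R).card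
      = ∑ _p : α, R := by
    simp only [Finset.card_eq_sum_ones, Finset.sum_filter]
    rw [Finset.sum_comm]
    refine Finset.sum_congr rfl fun p _ => ?_
    rw [← Finset.sum_filter, ← Finset.card_eq_sum_ones, card_perm_lt hR]
  simp only [h1, Finset.sum_const, Finset.card_univ, Fintype.card_fin, smul_eq_mul] at h2
  rw [h2, mul_comm]

variable {KT K N F R A : ℕ}

/-- The permutation that moves position `a` to `R` and then `R` to `r`. -/
def relocate (R r a : Fin K) : Equiv.Perm (Fin K) := Equiv.swap r R * Equiv.swap a R

lemma relocate_apply (R r a : Fin K) : relocate R r a a = r := by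
  simp [relocate]

/-- Only positions `≤ R` can land below `R`, and position `R` itself is below `A`. -/
lemma lt_of_relocate_lt {R r a y : Fin K} (hr : R ≤ r) (hR : (R : ℕ) < A)
    (h : relocate R r a y < R) : (y : ℕ) < A := by
  simp only [relocate, Equiv.Perm.mul_apply, Equiv.swap_apply_def, Fin.lt_def, Fin.le_def,
    Fin.ext_iff] at *
  split_ifs at h <;> omega

/-- With the symmetric placement, there are blocks serving `A` receivers each, in which every packet
is cached at `R` of the other served receivers. -/
lemma exists_blocks (hRK : R < K) (hRA : R < A) (hAK : A ≤ K) {C : Placement KT K N F}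
    {X : Type*} [Fintype X] (φ : Fin F ≃ Equiv.Perm (Fin K) × Fin A × X)
    (hrx : ∀ j p, p ∈ C.rx j ↔ ((φ p.2).1 j : ℕ) < R) (d : Fin K → Fin N) :
    ∃ (H : ℕ) (b : Fin H → Block K N F), H * A ≤ numMissing C d ∧
      (∀ m, ∀ j ∈ (b m).served, (b m).target j ∈ missing C d j) ∧
      (∀ j, ∀ p ∈ missing C d j, ∃ m, j ∈ (b m).served ∧ (b m).target j = p) ∧
      ∀ m, ∀ j ∈ (b m).served, (unaware C (b m) j).card + 1 + R ≤ A := by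
  classical
  have hA0 : 0 < A := by omega
  let R' : Fin K := ⟨R, hRK⟩
  let Ix := Equiv.Perm (Fin K) × {r : Fin K // R' ≤ r} × X
  -- The default value 0 is harmless: only served receivers, at positions below `A`, matter.
  let tag : Fin K → Fin A := fun a => if h : (a : ℕ) < A then ⟨a, h⟩ else ⟨0, hA0⟩
  have htag : ∀ a : Fin K, (h : (a : ℕ) < A) → tag a = ⟨a, h⟩ := fun a h => dif_pos h
  -- The receiver at position `a` of `I.1` gets a packet whose permutation puts it at `r ≥ R`, so
  -- that it lacks the packet. The tag records `a`, making the packet determine its block.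
  let tgt : Ix → Fin K → Packet N F := fun I j =>
    (d j, φ.symm (relocate R' I.2.1 (I.1 j) * I.1, tag (I.1 j), I.2.2))
  let blk : Ix → Block K N F := fun I =>
    { served := Finset.univ.filter fun j => (I.1 j : ℕ) < A
      target := tgt I
      inj := by
        intro j hj j' hj' h
        simp only [Finset.coe_filter, Finset.mem_univ, true_and, Set.mem_ofPred_eq] at hj hj'
        have h1 := φ.symm.injective (Prod.mk.inj h).2
        simp only [Prod.mk.injEq, htag _ hj, htag _ hj', Fin.mk.injEq] at h1
        exact I.1.injective (Fin.ext h1.2.1) }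
  have hserved : ∀ I j, j ∈ (blk I).served ↔ (I.1 j : ℕ) < A := fun I j => by simp [blk]
  have hperm : ∀ I j, (φ (tgt I j).2).1 = relocate R' I.2.1 (I.1 j) * I.1 := fun I j => by
    simp [tgt]
  have hpos : ∀ I j, (φ (tgt I j).2).1 j = I.2.1 := fun I j => by
    rw [hperm, Equiv.Perm.mul_apply, relocate_apply]
  have hmiss : ∀ I j, tgt I j ∈ missing C d j := fun I j => by
    refine Finset.mem_filter.2 ⟨Finset.mem_univ _, rfl, ?_⟩
    rw [hrx, hpos, not_lt]
    exact I.2.1.2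
  let E := Fintype.equivFin Ix
  refine ⟨Fintype.card Ix, fun m => blk (E.symm m), ?_, fun m j _ => hmiss _ j,
    fun j p hp => ?_, fun m j hj => ?_⟩
  · have h1 : (Finset.univ : Finset (Ix × Fin A)).card
        -- Pairs of a block and a position below `A` inject into pairs of a receiver and a missing
        -- packet.
        ≤ (Finset.univ.sigma fun j => missing C d j).card := by
      refine Finset.card_le_card_of_injOn
        (fun y => ⟨y.1.1.symm (Fin.castLE hAK y.2), tgt y.1 (y.1.1.symm (Fin.castLE hAK y.2))⟩)
        (fun y _ => by simpa using hmiss _ _) ?_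
      rintro ⟨⟨σ, r, x⟩, a⟩ - ⟨⟨σ', r', x'⟩, a'⟩ - h
      simp only [Sigma.mk.injEq, heq_eq_eq] at h
      obtain ⟨hj, h⟩ := h
      have hr := hpos (σ, r, x) (σ.symm (Fin.castLE hAK a))
      rw [h, hj, hpos] at hr
      have hr' : r' = r := Subtype.ext hr
      subst hr'
      have h2 := φ.symm.injective (Prod.mk.inj h).2
      simp only [Equiv.apply_symm_apply, Prod.mk.injEq] at h2
      obtain ⟨h3, h4, h5⟩ := h2
      rw [htag _ (by simp), htag _ (by simp)] at h4
      have h6 : a = a' := by simpa [Fin.ext_iff] using h4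
      subst h6
      rw [mul_left_cancel h3, h5]
    rw [Finset.card_sigma] at h1
    simpa [Finset.card_univ, numMissing, Ix] using h1
  · obtain ⟨-, hd, hn⟩ := Finset.mem_filter.1 hp
    rw [hrx, not_lt] at hn
    obtain ⟨n, f⟩ := p
    simp only at hd hn
    subst hd
    obtain ⟨π, e, x, hφ⟩ : ∃ π e x, φ f = (π, e, x) := ⟨_, _, _, rfl⟩
    rw [hφ] at hn
    simp only at hn
    let a : Fin K := Fin.castLE hAK e
    -- Undo the relocation: the tag gives the position of `j` in the block, and `π j` gives `r`.
    let σ : Equiv.Perm (Fin K) := (relocate R' (π j) a)⁻¹ * π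
    have hσ : σ j = a := by
      rw [Equiv.Perm.mul_apply, Equiv.Perm.inv_eq_iff_eq, relocate_apply]
    have ha : (a : ℕ) < A := by simp [a]
    refine ⟨E (σ, ⟨π j, hn⟩, x), ?_, ?_⟩
    · beta_reduce
      rw [Equiv.symm_apply_apply, hserved, hσ]
      exact ha
    · beta_reduce
      rw [Equiv.symm_apply_apply]
      simp only [blk, tgt, hσ, htag a ha]
      rw [Prod.mk.injEq, Equiv.symm_apply_eq, hφ]
      simp [σ, a]
  · set I := E.symm m
    replace hj := (hserved I j).1 hj
    have hc1 : (blk I).served.card = A := card_perm_lt hAK I.1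
    set ρ := Finset.univ.filter fun j' => ((φ (tgt I j).2).1 j' : ℕ) < R with hρ
    have hc2 : ρ.card = R := card_perm_lt hRK.le _
    -- The `R` receivers caching the packet are all served, and are neither `j` nor unaware.
    have hdis : Disjoint (unaware C (blk I) j ∪ {j}) ρ := by
      rw [Finset.disjoint_left]
      intro j' h1 h2
      rw [hρ, Finset.mem_filter] at h2
      rw [Finset.mem_union, Finset.mem_singleton, unaware, Finset.mem_filter] at h1
      rcases h1 with h1 | rfl
      · exact h1.2.2 ((hrx _ _).2 h2.2)
      · rw [hpos] at h2
        exact absurd h2.2 (not_lt.2 I.2.1.2)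
    have hdis' : Disjoint (unaware C (blk I) j) {j} := by
      simp [unaware]
    have hsub : unaware C (blk I) j ∪ {j} ∪ ρ ⊆ (blk I).served := by
      intro j' hj'
      rw [Finset.mem_union, Finset.mem_union, Finset.mem_singleton] at hj'
      rcases hj' with (h | rfl) | h
      · exact (Finset.mem_filter.1 h).1
      · exact (hserved _ _).2 hj
      · rw [hρ, Finset.mem_filter, hperm, Equiv.Perm.mul_apply] at h
        exact (hserved _ _).2 (lt_of_relocate_lt (R := R') I.2.1.2 hRA h.2)
    have := Finset.card_le_card hsub
    rwa [Finset.card_union_of_disjoint hdis, Finset.card_union_of_disjoint hdis',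
      Finset.card_singleton, hc1, hc2] at this

end Scheme

/-! ### Achieving the DoF -/

section Achievability

variable {KT KR N F : ℕ} {Ω : Type*} [MeasurableSpace Ω]

/-- With `q = α A / X`, sending `D / A` blocks takes `D / X` slots whatever `A` is, so both
subchannels meet the same deadline. -/
lemma slot_le {q α X : ℝ} {D H A : ℕ} (hα : 0 ≤ α) (hX : 0 < X) (hq : q = α * A / X)
    (hH : H * A ≤ D) :
    ENNReal.ofReal q / ENNReal.ofReal α * H ≤ ENNReal.ofReal (D / X) := by
  rcases hα.eq_or_lt with rfl | hα
  · simp [hq]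
  have hq0 : 0 ≤ q := by rw [hq]; positivity
  have hH' : (H : ℝ) * A ≤ D := by exact_mod_cast hH
  rw [← ENNReal.ofReal_div_of_pos hα, ← ENNReal.ofReal_natCast H,
    ← ENNReal.ofReal_mul (by positivity)]
  refine ENNReal.ofReal_le_ofReal ?_
  calc q / α * H = H * A / X := by rw [hq]; field_simp
    _ ≤ D / X := by gcongr

lemma le_dofOf {net : Network KT KR Ω} {C : Placement KT KR N F} {A B : ℕ}
    {q X : ℝ} (hX : X = net.α * A + (1 - net.α) * B) (hX0 : 0 < X) (hq : q = net.α * A / X)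
    (hP : ∀ d, ∃ (H : ℕ) (b : Fin H → Block KR N F),
      H * A ≤ numMissing C d ∧ Delivers (PFeasible net C q) C d b)
    (hN : ∀ d, ∃ (H : ℕ) (b : Fin H → Block KR N F),
      H * B ≤ numMissing C d ∧ Delivers (NFeasible net C q) C d b) :
    ENNReal.ofReal X ≤ dofOf net C q := by
  refine le_iInf₂ fun d hd => ?_
  obtain ⟨HP, bP, hHP, hbP⟩ := hP d
  obtain ⟨HN, bN, hHN, hbN⟩ := hN d
  refine le_trans ?_ (le_iSup_of_le HP <| le_iSup_of_le HN <| le_iSup_of_le bP <|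
    le_iSup_of_le bN <| le_iSup_of_le hbP <| le_iSup_of_le hbN le_rfl)
  have hq' : 1 - q = (1 - net.α) * B / X := by
    rw [hq, eq_div_iff hX0.ne', sub_mul, div_mul_cancel₀ _ hX0.ne', hX]
    ring
  have hT : deliveryTime net.α q HP HN ≤ ENNReal.ofReal (numMissing C d / X) :=
    max_le (slot_le net.α_nonneg hX0 hq hHP)
      (slot_le (sub_nonneg.2 net.α_le_one) hX0 hq' hHN)
  rw [ENNReal.le_div_iff_mul_le (Or.inr (by exact_mod_cast hd.ne'))
    (Or.inr (ENNReal.natCast_ne_top _))]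
  calc ENNReal.ofReal X * deliveryTime net.α q HP HN
      ≤ ENNReal.ofReal X * ENNReal.ofReal (numMissing C d / X) := by gcongr
    _ = numMissing C d := by
        rw [← ENNReal.ofReal_mul hX0.le, mul_div_cancel₀ _ hX0.ne', ENNReal.ofReal_natCast]

lemma exists_placement {S R A : ℕ} {μT μR : ℝ} (hR : R < KR)
    (hS : 0 < S) (hST : S ≤ KT) (hA : A = min (S + R) KR) (hμT : KT * μT = S) (hμR : KR * μR = R)
    (hdvd : KR.factorial * KT.factorial * A * (R + 1) ∣ F) (net : Network KT KR Ω) :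
    ∃ (C : Placement KT KR N F) (q : ℝ), C.Admissible μT μR ∧ q ∈ Set.Icc (0 : ℝ) 1 ∧
      ENNReal.ofReal (dofCentralized KT KR μT μR net.α) ≤ dofOf net C q := by
  classical
  obtain ⟨G, hG⟩ := hdvd
  -- One labelling serves both subchannels: `Fin A` is the tag for P-blocks, `Fin (R + 1)` that for
  -- N-blocks, and the rest is spare. This dictates the divisor of `F`.
  let ψ : Fin F ≃ Equiv.Perm (Fin KR) × Equiv.Perm (Fin KT) × Fin A × Fin (R + 1) × Fin G :=
    Fintype.equivOfCardEq (by
      simp only [Fintype.card_prod, Fintype.card_perm, Fintype.card_fin, hG]; ring)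
  let φP : Fin F ≃ Equiv.Perm (Fin KR) × Fin A × (Equiv.Perm (Fin KT) × Fin (R + 1) × Fin G) :=
    ψ.trans ⟨fun x => (x.1, x.2.2.1, x.2.1, x.2.2.2), fun x => (x.1, x.2.2.1, x.2.1, x.2.2.2),
      fun _ => rfl, fun _ => rfl⟩
  let φN : Fin F ≃ Equiv.Perm (Fin KR) × Fin (R + 1) × (Equiv.Perm (Fin KT) × Fin A × Fin G) :=
    ψ.trans ⟨fun x => (x.1, x.2.2.2.1, x.2.1, x.2.2.1, x.2.2.2.2),
      fun x => (x.1, x.2.2.1, x.2.2.2.1, x.2.1, x.2.2.2.2), fun _ => rfl, fun _ => rfl⟩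
  let C : Placement KT KR N F :=
    { tx := fun i => Finset.univ.filter fun p => ((ψ p.2).2.1 i : ℕ) < S
      rx := fun j => Finset.univ.filter fun p => ((ψ p.2).1 j : ℕ) < R }
  have hrx : ∀ j p, p ∈ C.rx j ↔ ((ψ p.2).1 j : ℕ) < R := fun j p => by simp [C]
  have htx : ∀ i p, p ∈ C.tx i ↔ ((ψ p.2).2.1 i : ℕ) < S := fun i p => by simp [C]
  have htxc : ∀ p, (Finset.univ.filter fun i => p ∈ C.tx i).card = S := fun p => by
    simp only [htx]
    exact card_perm_lt hST _
  have hA0 : R < A := by omega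
  have hKT : 0 < KT := by omega
  have hα := net.α_nonneg
  have hα1 : 0 ≤ 1 - net.α := sub_nonneg.2 net.α_le_one
  have hA1 : (1 : ℝ) ≤ A := by exact_mod_cast (by omega : 1 ≤ A)
  set X : ℝ := net.α * A + (1 - net.α) * ((R + 1 : ℕ) : ℝ) with hX
  have hX0 : 0 < X := by
    have h1 : net.α * 1 ≤ net.α * A := mul_le_mul_of_nonneg_left hA1 hα
    have h2 : 0 ≤ (1 - net.α) * R := by positivity
    rw [hX]
    push_cast
    linarith
  have hdof : dofCentralized KT KR μT μR net.α = X := by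
    have h1 : (1 : ℝ) + R ≤ KR := by exact_mod_cast (by omega : 1 + R ≤ KR)
    rw [dofCentralized, hμT, hμR, min_eq_left h1, hX, hA]
    push_cast
    ring
  rw [hdof]
  refine ⟨C, net.α * A / X, ⟨fun i => ?_, fun j => ?_⟩, ⟨by positivity, ?_⟩,
    le_dofOf hX hX0 rfl (fun d => ?_) (fun d => ?_)⟩
  · let e : Packet N F ≃ Equiv.Perm (Fin KT) ×
        (Fin N × Equiv.Perm (Fin KR) × Fin A × Fin (R + 1) × Fin G) :=
      ((Equiv.refl _).prodCongr ψ).trans ⟨fun x => (x.2.2.1, x.1, x.2.1, x.2.2.2),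
        fun x => (x.2.1, x.2.2.1, x.1, x.2.2.2), fun _ => rfl, fun _ => rfl⟩
    have h : KT * (C.tx i).card = S * Fintype.card (Packet N F) := card_filter_perm_lt hST e i
    have h' : (KT : ℝ) * (C.tx i).card = S * (N * F) := by
      simp only [Fintype.card_prod, Fintype.card_fin] at h
      exact_mod_cast h
    have h0 : (KT : ℝ) ≠ 0 := by exact_mod_cast hKT.ne'
    refine mul_left_cancel₀ h0 ?_
    rw [h', ← hμT]
    ring
  · let e : Packet N F ≃ Equiv.Perm (Fin KR) ×
        (Fin N × Equiv.Perm (Fin KT) × Fin A × Fin (R + 1) × Fin G) :=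
      ((Equiv.refl _).prodCongr ψ).trans ⟨fun x => (x.2.1, x.1, x.2.2),
        fun x => (x.2.1, x.1, x.2.2), fun _ => rfl, fun _ => rfl⟩
    have h : KR * (C.rx j).card = R * Fintype.card (Packet N F) := card_filter_perm_lt hR.le e j
    have h' : (KR : ℝ) * (C.rx j).card = R * (N * F) := by
      simp only [Fintype.card_prod, Fintype.card_fin] at h
      exact_mod_cast h
    have h0 : (KR : ℝ) ≠ 0 := by exact_mod_cast (by omega : KR ≠ 0)
    refine mul_left_cancel₀ h0 ?_
    rw [h', ← hμR]
    ring
  · rw [div_le_one hX0, hX]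
    have : 0 ≤ (1 - net.α) * ((R + 1 : ℕ) : ℝ) := by positivity
    linarith
  -- As `A ≤ S + R`, at most `S - 1` receivers are unaware, few enough for `S` transmitters.
  · obtain ⟨H, b, hH, hmiss, hcov, hun⟩ := exists_blocks hR hA0 (by omega) φP hrx d
    refine ⟨H, b, hH, fun m => pFeasible_of_unaware
      (fun j hj => (Finset.mem_filter.1 (hmiss m j hj)).2.2) (fun j hj => ?_), hmiss, hcov⟩
    have := hun m j hj
    rw [htxc]
    omega
  -- With blocks of `R + 1` receivers, nobody is unaware.
  · obtain ⟨H, b, hH, hmiss, hcov, hun⟩ := exists_blocks hR R.lt_succ_self hR φN hrx d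
    refine ⟨H, b, hH, fun m => nFeasible_of_unaware
      (fun j hj => (Finset.mem_filter.1 (hmiss m j hj)).2.2) (fun j hj => ?_) (fun j hj => ?_),
      hmiss, hcov⟩
    · have := hun m j hj
      exact Finset.card_eq_zero.1 (by omega)
    · obtain ⟨i, hi⟩ := Finset.card_pos.1 ((htxc ((b m).target j)).symm ▸ hS)
      exact ⟨i, (Finset.mem_filter.1 hi).2⟩

end Achievability

end CacheNet

end

theorem theorem1 (KT KR : ℕ) (hKR : 0 < KR) (μT μR : ℝ)
    (hμT0 : 0 ≤ μT) (hμT1 : μT ≤ 1) (hμR0 : 0 ≤ μR) (hμR1 : μR < 1)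
    (hcover : 1 ≤ KT * μT)
    (hintT : ∃ m : ℕ, KT * μT = m) (hintR : ∃ m : ℕ, KR * μR = m) :
    ∃ F₀ : ℕ, 0 < F₀ ∧
      ∀ (N F : ℕ), 0 < N → 0 < F →
      ∀ (Ω : Type*) [MeasurableSpace Ω] (net : CacheNet.Network KT KR Ω),
        (F₀ ∣ F →
          ∃ (C : CacheNet.Placement KT KR N F) (q : ℝ),
            C.Admissible μT μR ∧ q ∈ Set.Icc (0 : ℝ) 1 ∧
            ENNReal.ofReal (CacheNet.dofCentralized KT KR μT μR net.α)
              ≤ CacheNet.dofOf net C q) ∧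
        CacheNet.dofStar net N F μT μR / 2
          ≤ ENNReal.ofReal (CacheNet.dofCentralized KT KR μT μR net.α) := by
  obtain ⟨S, hS⟩ := hintT
  obtain ⟨R, hR⟩ := hintR
  have hKR' : (0 : ℝ) < KR := by exact_mod_cast hKR
  have hS0 : 0 < S := by
    rw [hS] at hcover
    exact_mod_cast hcover
  have hST : S ≤ KT := by
    have : (S : ℝ) ≤ KT := hS ▸ mul_le_of_le_one_right (Nat.cast_nonneg _) hμT1
    exact_mod_cast this
  have hRK : R < KR := by
    have : (R : ℝ) < KR := hR ▸ mul_lt_of_lt_one_right hKR' hμR1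
    exact_mod_cast this
  have hA : 0 < min (S + R) KR := by omega
  refine ⟨KR.factorial * KT.factorial * min (S + R) KR * (R + 1), by positivity,
    fun N F hN hF Ω _ net => ⟨fun hdvd => ?_, ?_⟩⟩
  · exact CacheNet.exists_placement hRK hS0 hST rfl hS hR hdvd net
  · exact CacheNet.dofStar_div_two_le net hN hF hRK hS0 hS hR
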